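/- Let $n\ge 1$, $k\ge 1$, write points of $\mathbb{C}^n$ as $z=('z,z_n)$ with $'z\in\mathbb{C}^{n-1}$, let $f_1,\dots,f_k$ be entire functions on $\mathbb{C}^{n-1}$, and put $$F(z)=z_n^k+f_1('z)z_n^{k-1}+\dots+f_k('z),\qquad A=\{z\in\mathbb{C}^n: F(z)=0\},\qquad X=\mathbb{C}^n\setminus A.$$ Conventions. A plurisubharmonic (psh) function has values in $[-\infty,+\infty)$, and its continuity is understood with respect to the topology of $[-\infty,+\infty]$. It is an exhaustion function of $X$ if all sets $\{z\in X:\rho(z)\le C\}$, $C\in\mathbb{R}$, are relatively compact in $X$. A psh function $u$ on an open set $U$ is maximal on $U$ if for every relatively compact open subset $G$ of $U$ and every upper semicontinuous $v:\overline G\to[-\infty,+\infty)$ that is psh on $G$ and satisfies $v\le u$ on $\partial G$ one has $v\le u$ on $G$. A connected Stein manifold $X$ is called $S^*$-parabolic if it has a continuous psh exhaustion function that is maximal on $X\setminus K$ for some compact $K\subset X$. Theorem (Weierstrass polynomial complement). $X$ is a connected Stein manifold and is $S^*$-parabolic. More precisely, the function $$\rho(z)=-\ln|F(z)|+\ln\bigl(|'z|^2+|F(z)-1|^2\bigr)$$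 (with $|\cdot|$ the Euclidean norm and $\ln 0=-\infty$) is a continuous psh exhaustion function of $X$; the set $Q=\{z: {}'z=0,\ F(z)=1\}\subset X$ is finite, $\rho(z)=-\infty$ for $z\in X$ exactly when $z\in Q$, and $\rho$ is maximal on $X\setminus Q$. -/

import Mathlib

namespace SStar

noncomputable section

/-! ### Plurisubharmonic and maximal functions on open subsets of a complex normed space -/

/-- Mean value over `[0, 2π]` of a function with values in `[-∞, +∞]`: the integral of the positive
part minus the integral of the negative part, divided by `2π`. For an upper semicontinuous function
with values in `[-∞, +∞)` the first term is finite, so the difference is the usual integral, with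
values in `[-∞, +∞)`. -/
def angularMean (g : ℝ → EReal) : EReal :=
  (((ENNReal.ofReal (2 * Real.pi))⁻¹ *
      ∫⁻ θ in Set.Ioc (0 : ℝ) (2 * Real.pi), (g θ).toENNReal : ENNReal) : EReal) -
    (((ENNReal.ofReal (2 * Real.pi))⁻¹ *
      ∫⁻ θ in Set.Ioc (0 : ℝ) (2 * Real.pi), (-(g θ)).toENNReal : ENNReal) : EReal)

/-- `u : U → [-∞, +∞)` is plurisubharmonic on the open set `U`: it is upper semicontinuous and
satisfies the sub-mean value inequality on every closed disc, contained in `U`, of every complex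
line. Only the values of `u` on `U` matter. -/
structure IsPSHOn {E : Type*} [NormedAddCommGroup E] [NormedSpace ℂ E]
    (u : E → EReal) (U : Set E) : Prop where
  lt_top : ∀ z ∈ U, u z < ⊤
  usc : UpperSemicontinuousOn u U
  le_mean : ∀ z w : E, (∀ t : ℂ, ‖t‖ ≤ 1 → z + t • w ∈ U) →
    u z ≤ angularMean (fun θ : ℝ => u (z + Complex.exp (θ * Complex.I) • w))

/-- `u` is a maximal plurisubharmonic function on the open set `U`: for every relatively compact
open subset `G` of `U`, an upper semicontinuous function `v` on the closure of `G` that is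
plurisubharmonic on `G` and satisfies `v ≤ u` on the boundary of `G` satisfies `v ≤ u` on `G`. -/
structure IsMaximalOn {E : Type*} [NormedAddCommGroup E] [NormedSpace ℂ E]
    (u : E → EReal) (U : Set E) : Prop where
  psh : IsPSHOn u U
  maximal : ∀ (G : Set E) (v : E → EReal), IsOpen G → IsCompact (closure G) → closure G ⊆ U →
    UpperSemicontinuousOn v (closure G) → IsPSHOn v G →
    (∀ z ∈ frontier G, v z ≤ u z) → ∀ z ∈ G, v z ≤ u z

/-- `u` is an exhaustion function of `X`: all its sublevel sets are relatively compact in `X`. -/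
def IsExhaustionOn {E : Type*} [TopologicalSpace E] (u : E → EReal) (X : Set E) : Prop :=
  ∀ C : ℝ, ∃ K : Set E, IsCompact K ∧ K ⊆ X ∧ {z ∈ X | u z ≤ (C : EReal)} ⊆ K

/-! ### Stein domains and parabolicity -/

/-- The holomorphically convex hull of `K` in `X`. -/
def holHull {E : Type*} [NormedAddCommGroup E] [NormedSpace ℂ E] (K X : Set E) : Set E :=
  {z ∈ X | ∀ g : E → ℂ, DifferentiableOn ℂ g X →
    ∀ C : ℝ, (∀ w ∈ K, ‖g w‖ ≤ C) → ‖g z‖ ≤ C}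

/-- An open subset `X` of a finite-dimensional complex vector space is a (connected) Stein manifold:
it is connected and holomorphically convex. Global holomorphic functions always separate points
and give local coordinates here, since linear functions do. -/
structure IsSteinDomain {E : Type*} [NormedAddCommGroup E] [NormedSpace ℂ E]
    (X : Set E) : Prop where
  isOpen : IsOpen X
  isConnected : IsConnected X
  holConvex : ∀ K : Set E, IsCompact K → K ⊆ X → IsCompact (holHull K X)

/-- `X` is `S*`-parabolic: it is Stein and has a continuous plurisubharmonic exhaustion function
that is maximal outside a compact subset. Plurisubharmonic functions take values in `[-∞, +∞)`,
and continuity refers to the topology of the extended real line. -/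
structure IsSStarParabolic {E : Type*} [NormedAddCommGroup E] [NormedSpace ℂ E]
    (X : Set E) : Prop where
  stein : IsSteinDomain X
  exists_exhaustion : ∃ ρ : E → EReal, IsPSHOn ρ X ∧ ContinuousOn ρ X ∧ IsExhaustionOn ρ X ∧
    ∃ K : Set E, IsCompact K ∧ K ⊆ X ∧ IsMaximalOn ρ (X \ K)

/-! ### Weierstrass polynomials -/

/-- The first `m` coordinates of a point of `ℂ^(m+1)`. -/
def headCoords {m : ℕ} (z : EuclideanSpace ℂ (Fin (m + 1))) : EuclideanSpace ℂ (Fin m) :=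
  WithLp.toLp 2 (fun i => z i.castSucc)

/-- The polynomial `z_n ^ k + f_1('z) z_n ^ (k-1) + … + f_k('z)` on `ℂ^n`, where `n = m + 1` and
`z = ('z, z_n)`. Only `f 1, …, f k` occur. -/
def weierstrassPoly {m : ℕ} (k : ℕ) (f : ℕ → EuclideanSpace ℂ (Fin m) → ℂ)
    (z : EuclideanSpace ℂ (Fin (m + 1))) : ℂ :=
  z (Fin.last m) ^ k + ∑ j ∈ Finset.Icc 1 k, f j (headCoords z) * z (Fin.last m) ^ (k - j)

/-- `-ln |F(z)| + ln (|'z|² + |F(z) - 1|²)` with `ln 0 = -∞` in the second term; it is meant for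
points with `F(z) ≠ 0`. -/
def specialExhaustion {m : ℕ} (F : EuclideanSpace ℂ (Fin (m + 1)) → ℂ)
    (z : EuclideanSpace ℂ (Fin (m + 1))) : EReal :=
  ((-Real.log ‖F z‖ : ℝ) : EReal) +
    ENNReal.log (ENNReal.ofReal (‖headCoords z‖ ^ 2 + ‖F z - 1‖ ^ 2))

end

end SStar

namespace SStar

open MeasureTheory Metric Filter Topology

noncomputable section

/-! On `X` the function is `ρ = -log ‖F‖ + log ‖Φ‖²`, where `Φ('z, z_n) = ('z, F(z) - 1)` maps `ℂ^n`
to itself. The first term is pluriharmonic on `X`, so everything local concerns `log ‖Φ‖²`.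

Plurisubharmonicity: if `p = Φ(z) ≠ 0`, Cauchy–Schwarz gives `‖Φ‖² ≥ |⟨p, Φ⟩|² / ‖p‖²` with equality
at `z`. Thus `ρ` has a minorant touching it at `z` that is the logarithm of the modulus of a
holomorphic function, and Jensen's formula gives the sub-mean value inequality
(`log_norm_le_angularMean`).

Maximality: `log ‖·‖²` is harmonic along complex lines through the origin. Since `Φ` maps between
spaces of equal dimension, some `ξ ≠ 0` is sent by its differential into the line of `p`
(`exists_ne_zero_map_eq_smul`). Along `ξ`, `ρ` is at most a harmonic function plus `O(|t|⁴)`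
(`exists_log_norm_sq_le_of_deriv_eq_smul`). If a competitor `v` exceeded `ρ`, then `v - ρ + ε‖z‖²`
would have an interior maximum for small `ε`. On small circles in the direction `ξ` the gain
`ε|t|²‖ξ‖²` beats the quartic error and violates the sub-mean value inequality for `v`
(`isMaximalOn_of_exists_direction`). No smoothness of `v` is needed.

Exhaustion: `ρ ≤ C` means `|'z|² + |F - 1|² ≤ e^C |F|`. This bounds `'z` and `F`, hence `z_n`
because `F` is monic in `z_n`, and it excludes `F = 0`. Holomorphic convexity comes from the
coordinates and `1/F`. -/

/-! ### Angular means and Jensen's formula -/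

/-- The angular mean only depends on almost everywhere values and is monotone. -/
theorem angularMean_mono_ae {g h : ℝ → EReal}
    (H : ∀ᵐ θ ∂(volume.restrict (Set.Ioc (0 : ℝ) (2 * Real.pi))), g θ ≤ h θ) :
    angularMean g ≤ angularMean h := by
  unfold angularMean
  apply EReal.sub_le_sub
  · rw [EReal.coe_ennreal_le_coe_ennreal_iff]
    gcongr 1
    apply lintegral_mono_ae
    filter_upwards [H] with θ hθ using EReal.toENNReal_le_toENNReal hθ
  · rw [EReal.coe_ennreal_le_coe_ennreal_iff]
    gcongr 1
    apply lintegral_mono_ae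
    filter_upwards [H] with θ hθ using EReal.toENNReal_le_toENNReal (EReal.neg_le_neg_iff.2 hθ)

/-- The angular mean of a circle integrable real function is its circle average. -/
theorem angularMean_coe_circleMap {b : ℂ → ℝ} {c : ℂ} {R : ℝ} (hb : CircleIntegrable b c R) :
    angularMean (fun θ => (b (circleMap c R θ) : EReal)) =
      (Real.circleAverage b c R : ℝ) := by
  have hpi : 0 < 2 * Real.pi := Real.two_pi_pos
  have hi : Integrable (fun θ => b (circleMap c R θ))
      (volume.restrict (Set.Ioc (0 : ℝ) (2 * Real.pi))) :=
    (intervalIntegrable_iff_integrableOn_Ioc_of_le hpi.le).1 hb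
  have hfin : ∀ φ : ℝ → ℝ, Integrable φ (volume.restrict (Set.Ioc (0 : ℝ) (2 * Real.pi))) →
      ((ENNReal.ofReal (2 * Real.pi))⁻¹ *
        ∫⁻ θ in Set.Ioc (0 : ℝ) (2 * Real.pi), ENNReal.ofReal (φ θ)) ≠ ⊤ := by
    intro φ hφ
    refine ENNReal.mul_ne_top (ENNReal.inv_ne_top.2 (ENNReal.ofReal_pos.2 hpi).ne') ?_
    exact hφ.lintegral_lt_top.ne
  unfold angularMean
  rw [Real.circleAverage_def, intervalIntegral.integral_of_le hpi.le,
    integral_eq_lintegral_pos_part_sub_lintegral_neg_part hi]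
  simp only [← EReal.coe_neg, EReal.real_coe_toENNReal]
  rw [← EReal.coe_ennreal_toReal (hfin _ hi),
    ← EReal.coe_ennreal_toReal (hfin (fun θ => -b (circleMap c R θ)) hi.neg),
    ← EReal.coe_sub, ENNReal.toReal_mul, ENNReal.toReal_mul, ENNReal.toReal_inv,
    ENNReal.toReal_ofReal hpi.le, smul_eq_mul, mul_sub]

/-- A function bounded above by the real part of a holomorphic function on a circle has angular
mean at most the value of this real part at the centre. -/
theorem angularMean_le_re_of_differentiableOn {g : ℝ → EReal} {H : ℂ → ℂ} {r : ℝ} (hr : 0 < r)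
    (hH : ∀ t ∈ closedBall (0 : ℂ) r, DifferentiableAt ℂ H t)
    (hg : ∀ θ, g θ ≤ ((H (circleMap 0 r θ)).re : EReal)) :
    angularMean g ≤ ((H 0).re : EReal) := by
  have hcont : ContinuousOn H (closedBall 0 r) := fun t ht =>
    (hH t ht).continuousAt.continuousWithinAt
  have hci : CircleIntegrable H 0 r :=
    ContinuousOn.circleIntegrable hr.le (hcont.mono sphere_subset_closedBall)
  have hcire : CircleIntegrable (fun t => (H t).re) 0 r :=
    ContinuousOn.circleIntegrable hr.le
      (Complex.continuous_re.comp_continuousOn (hcont.mono sphere_subset_closedBall))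
  have hav : Real.circleAverage H 0 r = H 0 := by
    refine circleAverage_of_differentiable_on_off_countable Set.countable_empty ?_ ?_
    · rwa [abs_of_pos hr]
    · intro t ht
      rw [abs_of_pos hr] at ht
      exact hH t (ball_subset_closedBall ht.1)
  have hre : Real.circleAverage (fun t => (H t).re) 0 r = (H 0).re := by
    rw [← hav, Real.circleAverage_def, Real.circleAverage_def, Complex.smul_re]
    congr 1
    exact Complex.reCLM.intervalIntegral_comp_comm hci
  rw [← hre, ← angularMean_coe_circleMap hcire]
  exact angularMean_mono_ae (Eventually.of_forall hg)

/-- Submean value inequality for `log ‖G‖`, for `G` holomorphic near the closed unit disc. -/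
theorem log_norm_le_angularMean {g : ℝ → EReal} {G : ℂ → ℂ}
    (hG : AnalyticOnNhd ℂ G (closedBall 0 1)) (hG0 : G 0 ≠ 0)
    (hg : ∀ θ, G (circleMap 0 1 θ) ≠ 0 → ((Real.log ‖G (circleMap 0 1 θ)‖ : ℝ) : EReal) ≤ g θ) :
    ((Real.log ‖G 0‖ : ℝ) : EReal) ≤ angularMean g := by
  have hG' : AnalyticOnNhd ℂ G (closedBall 0 |1|) := by rwa [abs_one]
  have hci : CircleIntegrable (fun t => Real.log ‖G t‖) 0 1 := by
    apply MeromorphicOn.circleIntegrable_log_norm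
    exact (hG'.mono sphere_subset_closedBall).meromorphicOn
  have hle : Real.log ‖G 0‖ ≤ Real.circleAverage (fun t => Real.log ‖G t‖) 0 1 := by
    have := AnalyticOnNhd.circleAverage_log_norm one_ne_zero hG' hG0
    rw [this]
    -- In Jensen's formula the excess of the mean over the central value is a sum over the zeros `u`
    -- in the disc. Each term is nonnegative because `‖u‖ ≤ 1`; the index `u = 0` contributes
    -- `Real.log 0 = 0`.
    have h0 : 0 ≤ ∑ᶠ u, MeromorphicOn.divisor G (closedBall 0 |1|) u *
        Real.log (1 * ‖(0 : ℂ) - u‖⁻¹) := by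
      apply finsum_nonneg
      intro u
      by_cases hu : u ∈ closedBall (0 : ℂ) |1|
      · apply mul_nonneg
        · exact_mod_cast (MeromorphicOn.AnalyticOnNhd.divisor_nonneg hG') u
        · rcases eq_or_ne u 0 with rfl | hu0
          · simp
          · apply Real.log_nonneg
            rw [one_mul, zero_sub, norm_neg]
            refine (one_le_inv₀ (norm_pos_iff.2 hu0)).2 ?_
            simpa using hu
      · simp [Function.locallyFinsuppWithin.apply_eq_zero_of_notMem _ hu]
    linarith
  -- At a zero of `G` on the circle the junk value `Real.log 0 = 0` need not lie below `g`. There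
  -- are finitely many zeros, so these angles form a null set.
  have hfin : (closedBall (0 : ℂ) 1 \ G ⁻¹' {0}ᶜ).Finite := by
    apply IsCompact.finite_sdiff_of_mem_codiscreteWithin (isCompact_closedBall _ _)
    exact hG.preimage_zero_mem_codiscreteWithin hG0 (by simp)
      ⟨⟨0, by simp⟩, (convex_closedBall _ _).isPreconnected⟩
  have hnull := (hfin.countable.preimage_circleMap 0 one_ne_zero).measure_zero volume
  calc ((Real.log ‖G 0‖ : ℝ) : EReal)
      ≤ ((Real.circleAverage (fun t => Real.log ‖G t‖) 0 1 : ℝ) : EReal) :=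
        EReal.coe_le_coe_iff.2 hle
    _ = angularMean (fun θ => ((Real.log ‖G (circleMap 0 1 θ)‖ : ℝ) : EReal)) :=
        (angularMean_coe_circleMap hci).symm
    _ ≤ angularMean g := by
        apply angularMean_mono_ae
        apply ae_restrict_of_ae
        filter_upwards [measure_eq_zero_iff_ae_notMem.mp hnull] with θ hθ
        apply hg
        intro h0
        apply hθ
        exact ⟨sphere_subset_closedBall (circleMap_mem_sphere 0 zero_le_one θ), by simp [h0]⟩

/-! ### A criterion for maximality -/

/-- A plurisubharmonic function, real valued and continuous on `Ω`, is maximal if through every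
point there is a complex direction along which it is bounded above, to fourth order, by a harmonic
function with the same value at the point. -/
theorem isMaximalOn_of_exists_direction {E : Type*} [NormedAddCommGroup E] [InnerProductSpace ℂ E]
    {u : E → EReal} {U : E → ℝ} {Ω : Set E} (hpsh : IsPSHOn u Ω) (hU : ContinuousOn U Ω)
    (huU : ∀ z ∈ Ω, u z = U z)
    (H : ∀ z ∈ Ω, ∃ ξ : E, ξ ≠ 0 ∧ ∃ (g : ℂ → ℂ) (C : ℝ), g 0 = 0 ∧
      (∀ᶠ t in 𝓝 (0 : ℂ), DifferentiableAt ℂ g t) ∧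
      ∀ᶠ t in 𝓝 (0 : ℂ), U (z + t • ξ) ≤ U z + (g t).re + C * ‖t‖ ^ 4) :
    IsMaximalOn u Ω := by
  refine ⟨hpsh, ?_⟩
  intro G v hGo hGc hGΩ husc hv hfr z₀ hz₀
  by_contra hlt
  rw [not_le] at hlt
  have hclosure : ∀ z ∈ closure G, z ∉ G → v z ≤ U z := by
    intro z hz hzG
    rw [← huU z (hGΩ hz)]
    exact hfr z ⟨hz, by rwa [hGo.interior_eq]⟩
  have hvtop : ∀ z ∈ closure G, v z ≠ ⊤ := by
    intro z hz
    by_cases hzG : z ∈ G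
    · exact (hv.lt_top z hzG).ne
    · exact ((hclosure z hz hzG).trans_lt (EReal.coe_lt_top _)).ne
  have hz₀c := subset_closure hz₀
  rw [huU z₀ (hGΩ hz₀c)] at hlt
  obtain ⟨a, ha⟩ : ∃ a : ℝ, v z₀ = a :=
    ⟨_, (EReal.coe_toReal (hvtop z₀ hz₀c) ((EReal.bot_lt_coe _).trans hlt).ne').symm⟩
  rw [ha, EReal.coe_lt_coe_iff] at hlt
  obtain ⟨R, hR, hRle⟩ := hGc.isBounded.exists_pos_norm_le
  -- The perturbation `ε‖z‖²` is at most `ε R²` on the closure of `G`, less than the excess of `v`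
  -- over `U` at `z₀`. Hence the maximum of `v - U + ε‖z‖²` cannot occur on the boundary.
  obtain ⟨ε, hε, hεR⟩ : ∃ ε : ℝ, 0 < ε ∧ ε * R ^ 2 < a - U z₀ := by
    refine ⟨(a - U z₀) / (2 * R ^ 2), by have := sub_pos.2 hlt; positivity, ?_⟩
    have h1 : (a - U z₀) / (2 * R ^ 2) * R ^ 2 = (a - U z₀) / 2 := by field_simp
    linarith
  set b : E → ℝ := fun z => -U z + ε * ‖z‖ ^ 2 with hb
  have hbcont : ContinuousOn b (closure G) :=
    (hU.mono hGΩ).neg.add (by fun_prop)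
  have hψ : UpperSemicontinuousOn (fun z => v z + (b z : EReal)) (closure G) := by
    refine husc.add' ?_ ?_
    · exact (continuous_coe_real_ereal.comp_continuousOn hbcont).upperSemicontinuousOn
    · intro z hz
      exact EReal.continuousAt_add (.inl (hvtop z hz)) (.inr (EReal.coe_ne_top _))
  obtain ⟨z₁, hz₁c, hmax⟩ := hψ.exists_isMaxOn ⟨z₀, hz₀c⟩ hGc
  have hmax0 : ((a + b z₀ : ℝ) : EReal) ≤ v z₁ + (b z₁ : EReal) := by
    have := hmax hz₀c
    simpa [ha] using this
  have hz₁ : z₁ ∈ G := by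
    by_contra hz₁G
    have h1 := hmax0.trans (add_le_add_left (hclosure z₁ hz₁c hz₁G) _)
    rw [← EReal.coe_add, EReal.coe_le_coe_iff] at h1
    have h2 : ε * ‖z₁‖ ^ 2 ≤ ε * R ^ 2 := by
      have := hRle z₁ hz₁c
      gcongr
    have h3 : 0 ≤ ε * ‖z₀‖ ^ 2 := by positivity
    simp only [hb] at h1
    linarith
  obtain ⟨a₁, ha₁⟩ : ∃ a₁ : ℝ, v z₁ = a₁ := by
    refine ⟨_, (EReal.coe_toReal (hvtop z₁ hz₁c) ?_).symm⟩
    intro hbot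
    rw [hbot, EReal.bot_add] at hmax0
    exact (EReal.bot_lt_coe _).not_ge hmax0
  have hvle : ∀ z ∈ closure G, v z ≤ ((a₁ + b z₁ - b z : ℝ) : EReal) := by
    intro z hz
    have h1 : v z + (b z : EReal) ≤ v z₁ + (b z₁ : EReal) := hmax hz
    rw [ha₁] at h1
    by_cases hbot : v z = ⊥
    · rw [hbot]; exact bot_le
    · lift v z to ℝ using ⟨hvtop z hz, hbot⟩ with x
      rw [← EReal.coe_add, ← EReal.coe_add, EReal.coe_le_coe_iff] at h1
      rw [EReal.coe_le_coe_iff]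
      linarith
  obtain ⟨ξ, hξ, g, C, hg0, hgd, hgle⟩ := H z₁ (hGΩ hz₁c)
  have hmem : ∀ᶠ t in 𝓝 (0 : ℂ), z₁ + t • ξ ∈ G := by
    have hc : Continuous fun t : ℂ => z₁ + t • ξ := by fun_prop
    exact hc.continuousAt.eventually (hGo.mem_nhds (by simpa using hz₁))
  have hsmall : ∀ᶠ t in 𝓝 (0 : ℂ), C * ‖t‖ ^ 2 < ε * ‖ξ‖ ^ 2 := by
    have hc : Continuous fun t : ℂ => C * ‖t‖ ^ 2 := by fun_prop
    refine hc.continuousAt.eventually (gt_mem_nhds ?_)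
    have := norm_pos_iff.2 hξ
    simp only [norm_zero, ne_eq, OfNat.ofNat_ne_zero, not_false_eq_true, zero_pow, mul_zero]
    positivity
  obtain ⟨δ, hδ, hball⟩ := Metric.eventually_nhds_iff_ball.1
    (hgd.and (hgle.and (hmem.and hsmall)))
  set r : ℝ := δ / 2 with hr
  have hr0 : 0 < r := by positivity
  have hsub : closedBall (0 : ℂ) r ⊆ ball 0 δ := closedBall_subset_ball (by linarith)
  have hC : C * r ^ 2 < ε * ‖ξ‖ ^ 2 := by
    have := (hball (r : ℂ) (hsub (by simp [abs_of_pos hr0]))).2.2.2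
    simpa [abs_of_pos hr0] using this
  have hmean := hv.le_mean z₁ ((r : ℂ) • ξ) (by
    intro t ht
    rw [smul_smul]
    refine (hball _ (hsub ?_)).2.2.1
    rw [mem_closedBall_zero_iff, norm_mul, Complex.norm_real, Real.norm_of_nonneg hr0.le]
    nlinarith)
  -- The real part of `K` bounds `v` on the circle `‖t‖ = r`. There `C‖t‖⁴` and `ε‖t‖²‖ξ‖²` are
  -- constants, so they can be absorbed without losing holomorphy. The choice of `r` makes their
  -- difference negative, so `K 0` has real part below `v z₁`.
  let K : ℂ → ℂ := fun t =>
    a₁ + g t - 2 * ε * (t * inner ℂ z₁ ξ) + ((C * r ^ 4 - ε * (r ^ 2 * ‖ξ‖ ^ 2) : ℝ) : ℂ)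
  have hK : angularMean (fun θ : ℝ => v (z₁ + Complex.exp (θ * Complex.I) • (r : ℂ) • ξ)) ≤
      ((K 0).re : EReal) := by
    refine angularMean_le_re_of_differentiableOn hr0 (H := K) ?_ ?_
    · intro t ht
      have := (hball t (hsub ht)).1
      fun_prop
    · intro θ
      set t := circleMap 0 r θ with ht
      have htr : ‖t‖ = r := by simp [ht, abs_of_pos hr0]
      have hpt : z₁ + Complex.exp (θ * Complex.I) • (r : ℂ) • ξ = z₁ + t • ξ := by
        rw [smul_smul, ht, circleMap_zero, mul_comm]
      obtain ⟨-, h1, h2, -⟩ := hball t (hsub (by simp [htr]))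
      rw [hpt]
      refine (hvle _ (subset_closure h2)).trans (EReal.coe_le_coe_iff.2 ?_)
      have h3 : ‖z₁ + t • ξ‖ ^ 2 = ‖z₁‖ ^ 2 + 2 * (t * inner ℂ z₁ ξ).re + r ^ 2 * ‖ξ‖ ^ 2 := by
        rw [norm_add_sq (𝕜 := ℂ), inner_smul_right, norm_smul, htr, mul_pow]
        rfl
      have h4 : (K t).re = a₁ + (g t).re - 2 * ε * (t * inner ℂ z₁ ξ).re +
          (C * r ^ 4 - ε * (r ^ 2 * ‖ξ‖ ^ 2)) := by
        have h5 : (2 * (ε : ℂ) * (t * inner ℂ z₁ ξ)).re = 2 * ε * (t * inner ℂ z₁ ξ).re := by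
          rw [← Complex.re_ofReal_mul]
          push_cast
          rfl
        simp only [K, Complex.add_re, Complex.sub_re, Complex.ofReal_re, h5]
      rw [h4]
      simp only [hb]
      rw [h3]
      rw [htr] at h1
      linarith
  have hfinal := hmean.trans hK
  rw [ha₁, EReal.coe_le_coe_iff] at hfinal
  have hK0 : (K 0).re = a₁ + (C * r ^ 4 - ε * (r ^ 2 * ‖ξ‖ ^ 2)) := by
    simp only [K, hg0, zero_mul, mul_zero, sub_zero, add_zero, Complex.add_re, Complex.ofReal_re]
  rw [hK0] at hfinal
  have : C * r ^ 4 - ε * (r ^ 2 * ‖ξ‖ ^ 2) = r ^ 2 * (C * r ^ 2 - ε * ‖ξ‖ ^ 2) := by ring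
  nlinarith [pow_pos hr0 2]

/-! ### Harmonic majorants along a direction -/

/-- An endomorphism of a finite-dimensional space maps some nonzero vector to a multiple of a given
nonzero vector. -/
theorem exists_ne_zero_map_eq_smul {𝕜 V : Type*} [Field 𝕜] [AddCommGroup V] [Module 𝕜 V]
    [FiniteDimensional 𝕜 V] (L : V →ₗ[𝕜] V) {p : V} (hp : p ≠ 0) :
    ∃ ξ : V, ξ ≠ 0 ∧ ∃ c : 𝕜, L ξ = c • p := by
  by_cases hL : Function.Injective L
  · obtain ⟨ξ, hξ⟩ := LinearMap.injective_iff_surjective.1 hL p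
    refine ⟨ξ, ?_, 1, by simp [hξ]⟩
    rintro rfl
    exact hp (by simpa using hξ.symm)
  · rw [injective_iff_map_eq_zero] at hL
    push Not at hL
    obtain ⟨ξ, h0, hξ⟩ := hL
    exact ⟨ξ, hξ, 0, by simp [h0]⟩

/-- If `h'(0)` is a multiple of `h(0) ≠ 0` then `log ‖h‖²` is bounded above, to fourth order, by a
harmonic function with the same value at `0`. -/
theorem exists_log_norm_sq_le_of_deriv_eq_smul {V : Type*} [NormedAddCommGroup V]
    [InnerProductSpace ℂ V] [CompleteSpace V] {h : ℂ → V} (hh : Differentiable ℂ h)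
    (h0 : h 0 ≠ 0) {c : ℂ} (hc : deriv h 0 = c • h 0) :
    ∃ (g : ℂ → ℂ) (C : ℝ), g 0 = 0 ∧ Differentiable ℂ g ∧
      ∀ᶠ t in 𝓝 (0 : ℂ),
        Real.log (‖h t‖ ^ 2) ≤ Real.log (‖h 0‖ ^ 2) + (g t).re + C * ‖t‖ ^ 4 := by
  set p := h 0 with hp
  have hp0 : 0 < ‖p‖ := norm_pos_iff.2 h0
  -- Multiplying by `exp (-(c t))` kills the derivative at `0` and changes `log ‖h‖²` only by a
  -- harmonic term. This leaves `k t = p + t² q t` with `q` entire.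
  let k : ℂ → V := fun t => Complex.exp (-(c * t)) • h t
  have hk : Differentiable ℂ k := by fun_prop
  have hk0 : k 0 = p := by simp [k, hp]
  have hk' : deriv k 0 = 0 := by
    have h1 : HasDerivAt (fun t : ℂ => Complex.exp (-(c * t))) (-c) 0 := by
      have := ((hasDerivAt_id (0 : ℂ)).const_mul c).neg.cexp
      simpa using this
    have h2 := h1.smul (hh 0).hasDerivAt
    rw [show deriv k 0 = _ from h2.deriv, hc]
    simp [hp]
  have hdiff : ∀ f : ℂ → V, Differentiable ℂ f → Differentiable ℂ (dslope f 0) := by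
    intro f hf
    rw [← differentiableOn_univ]
    exact (Complex.differentiableOn_dslope univ_mem).2 hf.differentiableOn
  let q : ℂ → V := dslope (dslope k 0) 0
  have hq : Differentiable ℂ q := hdiff _ (hdiff _ hk)
  have hkq : ∀ t, k t = p + t ^ 2 • q t := by
    intro t
    have h1 := sub_smul_dslope k 0 t
    have h2 := sub_smul_dslope (dslope k 0) 0 t
    rw [dslope_same, hk', sub_zero, sub_zero] at h2
    rw [← h2, sub_zero, hk0, smul_smul, ← sq] at h1
    rw [h1]
    abel
  have hnorm : ∀ t, ‖h t‖ ^ 2 = Real.exp (2 * (c * t).re) * ‖p + t ^ 2 • q t‖ ^ 2 := by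
    intro t
    have h1 : h t = Complex.exp (c * t) • (p + t ^ 2 • q t) := by
      rw [← hkq, smul_smul, ← Complex.exp_add]
      simp
    rw [h1, norm_smul, Complex.norm_exp, mul_pow, ← Real.exp_nat_mul]
    norm_num
  -- Apply `log x ≤ x - 1` to `x = ‖p + t² q‖² / ‖p‖²`. The cross term of the expanded square is the
  -- real part of a holomorphic function, and the remaining term is `|t|⁴ ‖q t‖² / ‖p‖²`, where `‖q
  -- t‖² < ‖q 0‖² + 1` near `0`.
  refine ⟨fun t => 2 * (c * t) + (2 / ‖p‖ ^ 2 : ℝ) * (t ^ 2 * inner ℂ p (q t)),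
    (‖q 0‖ ^ 2 + 1) / ‖p‖ ^ 2, by simp, ?_, ?_⟩
  · have : Differentiable ℂ fun t => inner ℂ p (q t) :=
      (innerSL ℂ p).differentiable.comp hq
    fun_prop
  · have hev : ∀ᶠ t in 𝓝 (0 : ℂ), ‖q t‖ ^ 2 < ‖q 0‖ ^ 2 + 1 :=
      (hq.continuous.norm.pow 2).continuousAt.eventually (gt_mem_nhds (lt_add_one _))
    have hne : ∀ᶠ t in 𝓝 (0 : ℂ), h t ≠ 0 := hh.continuous.continuousAt.eventually_ne h0
    filter_upwards [hev, hne] with t hqt hht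
    set s := ‖p + t ^ 2 • q t‖ ^ 2 with hs
    have hs0 : 0 < s := by
      have h1 : 0 < ‖h t‖ ^ 2 := by have := norm_pos_iff.2 hht; positivity
      rw [hnorm] at h1
      exact pos_of_mul_pos_right h1 (Real.exp_pos _).le
    have hlog : Real.log (‖h t‖ ^ 2) = 2 * (c * t).re + Real.log s := by
      rw [hnorm, Real.log_mul (Real.exp_pos _).ne' hs0.ne', Real.log_exp]
    have hlogs : Real.log s ≤ Real.log (‖p‖ ^ 2) + (s / ‖p‖ ^ 2 - 1) := by
      have := Real.log_le_sub_one_of_pos (x := s / ‖p‖ ^ 2) (by positivity)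
      rw [Real.log_div hs0.ne' (by positivity)] at this
      linarith
    have hsexp : s = ‖p‖ ^ 2 + 2 * (t ^ 2 * inner ℂ p (q t)).re + ‖t‖ ^ 4 * ‖q t‖ ^ 2 := by
      rw [hs, norm_add_sq (𝕜 := ℂ), inner_smul_right, norm_smul, norm_pow, mul_pow, ← pow_mul]
      rfl
    have hre : (2 * (c * t) + (2 / ‖p‖ ^ 2 : ℝ) * (t ^ 2 * inner ℂ p (q t)) : ℂ).re =
        2 * (c * t).re + 2 / ‖p‖ ^ 2 * (t ^ 2 * inner ℂ p (q t)).re := by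
      rw [Complex.add_re, Complex.re_ofReal_mul]
      congr 1
      simp
    rw [hlog, hre]
    have hdiv : s / ‖p‖ ^ 2 - 1 = 2 / ‖p‖ ^ 2 * (t ^ 2 * inner ℂ p (q t)).re +
        ‖q t‖ ^ 2 / ‖p‖ ^ 2 * ‖t‖ ^ 4 := by
      rw [hsexp]
      field_simp
      ring
    have hlast : ‖q t‖ ^ 2 / ‖p‖ ^ 2 * ‖t‖ ^ 4 ≤ (‖q 0‖ ^ 2 + 1) / ‖p‖ ^ 2 * ‖t‖ ^ 4 := by
      gcongr
    linarith

/-- Near a zero-free point, `log ‖F‖` is the real part of a holomorphic function. -/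
theorem exists_log_norm_eq_re {F : ℂ → ℂ} (hF : Differentiable ℂ F) (h0 : F 0 ≠ 0) :
    ∃ g : ℂ → ℂ, g 0 = 0 ∧ (∀ᶠ t in 𝓝 (0 : ℂ), DifferentiableAt ℂ g t) ∧
      ∀ᶠ t in 𝓝 (0 : ℂ), Real.log ‖F t‖ = Real.log ‖F 0‖ + (g t).re := by
  have hd : Differentiable ℂ fun t => F t / F 0 := hF.div_const _
  have hslit : ∀ᶠ t in 𝓝 (0 : ℂ), F t / F 0 ∈ Complex.slitPlane :=
    hd.continuous.continuousAt.eventually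
      (Complex.isOpen_slitPlane.mem_nhds (by simp [h0]))
  refine ⟨fun t => Complex.log (F t / F 0), by simp [h0], ?_, ?_⟩
  · filter_upwards [hslit] with t ht
    exact (hd t).clog ht
  · filter_upwards [hF.continuous.continuousAt.eventually_ne h0] with t ht
    rw [Complex.log_re, norm_div, Real.log_div (norm_ne_zero_iff.2 ht) (norm_ne_zero_iff.2 h0)]
    ring

/-! ### The functions `-log ‖F‖ + log ‖Φ‖²` -/

/-- The extended real valued function `-log ‖F‖ + log ‖Φ‖²`. -/
def logQuotient {E V : Type*} [NormedAddCommGroup V] (Φ : E → V) (F : E → ℂ) (z : E) : EReal :=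
  ((-Real.log ‖F z‖ : ℝ) : EReal) + ENNReal.log (ENNReal.ofReal (‖Φ z‖ ^ 2))

theorem logQuotient_eq_coe {E V : Type*} [NormedAddCommGroup V] {Φ : E → V} {F : E → ℂ} {z : E}
    (hΦ : Φ z ≠ 0) :
    logQuotient Φ F z = ((-Real.log ‖F z‖ + Real.log (‖Φ z‖ ^ 2) : ℝ) : EReal) := by
  have := norm_pos_iff.2 hΦ
  rw [logQuotient, ENNReal.log_ofReal_of_pos (by positivity), EReal.coe_add]

theorem logQuotient_eq_bot_iff {E V : Type*} [NormedAddCommGroup V] {Φ : E → V} {F : E → ℂ}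
    {z : E} : logQuotient Φ F z = ⊥ ↔ Φ z = 0 := by
  constructor
  · intro h
    by_contra hΦ
    rw [logQuotient_eq_coe hΦ] at h
    exact EReal.coe_ne_bot _ h
  · intro h
    simp [logQuotient, h]

theorem logQuotient_lt_top {E V : Type*} [NormedAddCommGroup V] (Φ : E → V) (F : E → ℂ)
    (z : E) : logQuotient Φ F z < ⊤ := by
  by_cases h : Φ z = 0
  · rw [logQuotient_eq_bot_iff.2 h]
    exact bot_lt_top
  · rw [logQuotient_eq_coe h]
    exact EReal.coe_lt_top _

/-- The first summand is finite, so addition in `EReal` is continuous at every pair that occurs,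
including where `Φ` vanishes. -/
theorem continuousOn_logQuotient {E V : Type*} [TopologicalSpace E] [NormedAddCommGroup V]
    {Φ : E → V} {F : E → ℂ} (hΦ : Continuous Φ) (hF : Continuous F) :
    ContinuousOn (logQuotient Φ F) {z | F z ≠ 0} := by
  intro z hz
  have h1 : ContinuousAt (fun z => ((-Real.log ‖F z‖ : ℝ) : EReal)) z :=
    continuous_coe_real_ereal.continuousAt.comp
      (hF.norm.continuousAt.log (norm_ne_zero_iff.2 hz)).neg
  have h2 : ContinuousAt (fun z => ENNReal.log (ENNReal.ofReal (‖Φ z‖ ^ 2))) z :=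
    (ENNReal.continuous_log.comp
      (ENNReal.continuous_ofReal.comp (hΦ.norm.pow 2))).continuousAt
  have h3 : ContinuousAt (fun p : EReal × EReal => p.1 + p.2)
      (((-Real.log ‖F z‖ : ℝ) : EReal), ENNReal.log (ENNReal.ofReal (‖Φ z‖ ^ 2))) :=
    EReal.continuousAt_add (.inl (EReal.coe_ne_top _)) (.inl (EReal.coe_ne_bot _))
  exact (ContinuousAt.comp (f := fun z => (((-Real.log ‖F z‖ : ℝ) : EReal),
    ENNReal.log (ENNReal.ofReal (‖Φ z‖ ^ 2)))) h3 (h1.prodMk h2)).continuousWithinAt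

theorem isPSHOn_logQuotient {E V : Type*} [NormedAddCommGroup E] [NormedSpace ℂ E]
    [NormedAddCommGroup V] [InnerProductSpace ℂ V] {Φ : E → V} {F : E → ℂ}
    (hΦ : Differentiable ℂ Φ) (hF : Differentiable ℂ F) :
    IsPSHOn (logQuotient Φ F) {z | F z ≠ 0} := by
  refine ⟨fun z _ => logQuotient_lt_top Φ F z,
    (continuousOn_logQuotient hΦ.continuous hF.continuous).upperSemicontinuousOn, ?_⟩
  intro z w hdisc
  by_cases h0 : Φ z = 0
  · rw [logQuotient_eq_bot_iff.2 h0]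
    exact bot_le
  have hp0 : 0 < ‖Φ z‖ := norm_pos_iff.2 h0
  have hF0 : F z ≠ 0 := by simpa using hdisc 0 (by simp)
  -- By Cauchy–Schwarz `‖G‖ ≤ ‖Φ‖² / ‖F‖` along the disc, with equality at `t = 0`. The square
  -- matches the exponent in `log ‖Φ‖²`.
  let G : ℂ → ℂ := fun t =>
    inner ℂ (Φ z) (Φ (z + t • w)) ^ 2 / ((‖Φ z‖ ^ 2 : ℝ) * F (z + t • w))
  have hi : Differentiable ℂ fun t : ℂ => inner ℂ (Φ z) (Φ (z + t • w)) :=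
    (innerSL ℂ (Φ z)).differentiable.comp (hΦ.comp (by fun_prop))
  have hFt : Differentiable ℂ fun t : ℂ => F (z + t • w) := hF.comp (by fun_prop)
  have hnn : ((‖Φ z‖ ^ 2 : ℝ) : ℂ) ≠ 0 := by
    rw [Complex.ofReal_ne_zero]
    positivity
  have hG : AnalyticOnNhd ℂ G (closedBall 0 1) := by
    have hopen : IsOpen {t : ℂ | F (z + t • w) ≠ 0} :=
      isOpen_ne_fun hFt.continuous continuous_const
    have hd : DifferentiableOn ℂ G {t : ℂ | F (z + t • w) ≠ 0} := by
      intro t ht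
      exact (((hi t).pow 2).div ((hFt t).const_mul _)
        (mul_ne_zero hnn ht)).differentiableWithinAt
    refine (hd.analyticOnNhd hopen).mono fun t ht => ?_
    exact hdisc t (by simpa using ht)
  have hnormG : ∀ t, ‖G t‖ = ‖inner ℂ (Φ z) (Φ (z + t • w))‖ ^ 2 /
      (‖Φ z‖ ^ 2 * ‖F (z + t • w)‖) := by
    intro t
    simp [G]
  have hG0 : ‖G 0‖ = ‖Φ z‖ ^ 2 / ‖F z‖ := by
    rw [hnormG, zero_smul, add_zero, inner_self_eq_norm_sq_to_K]
    have := norm_pos_iff.2 hF0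
    simp only [norm_pow, Complex.coe_algebraMap, Complex.norm_real, norm_norm]
    field_simp
  have hFz := norm_pos_iff.2 hF0
  have hlhs : logQuotient Φ F z = ((Real.log ‖G 0‖ : ℝ) : EReal) := by
    rw [logQuotient_eq_coe h0, hG0, Real.log_div (by positivity) hFz.ne']
    congr 1
    ring
  rw [hlhs]
  refine log_norm_le_angularMean hG ?_ ?_
  · rw [← norm_pos_iff, hG0]
    positivity
  · intro θ hθ
    have hcm : circleMap 0 1 θ = Complex.exp (θ * Complex.I) := by simp [circleMap]
    rw [hcm] at hθ ⊢
    set y := z + Complex.exp (θ * Complex.I) • w with hy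
    have hFy : 0 < ‖F y‖ := norm_pos_iff.2 (hdisc _ (by simp [Complex.norm_exp_ofReal_mul_I]))
    have hΦy : Φ y ≠ 0 := by
      intro h
      apply hθ
      simp only [G]
      rw [← hy, h]
      simp
    have hΦy' := norm_pos_iff.2 hΦy
    rw [logQuotient_eq_coe hΦy, EReal.coe_le_coe_iff]
    have hle : ‖G (Complex.exp (θ * Complex.I))‖ ≤ ‖Φ y‖ ^ 2 / ‖F y‖ := by
      rw [hnormG, ← hy, div_le_div_iff₀ (by positivity) hFy]
      have := norm_inner_le_norm (𝕜 := ℂ) (Φ z) (Φ y)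
      calc ‖inner ℂ (Φ z) (Φ y)‖ ^ 2 * ‖F y‖ ≤ (‖Φ z‖ * ‖Φ y‖) ^ 2 * ‖F y‖ := by gcongr
        _ = ‖Φ y‖ ^ 2 * (‖Φ z‖ ^ 2 * ‖F y‖) := by ring
    refine (Real.log_le_log (norm_pos_iff.2 hθ) hle).trans_eq ?_
    rw [Real.log_div (by positivity) hFy.ne']
    ring

theorem IsPSHOn.mono {E : Type*} [NormedAddCommGroup E] [NormedSpace ℂ E] {u : E → EReal}
    {U V : Set E} (hu : IsPSHOn u V) (h : U ⊆ V) : IsPSHOn u U :=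
  ⟨fun z hz => hu.lt_top z (h hz), hu.usc.mono h, fun z w hd => hu.le_mean z w fun t ht =>
    h (hd t ht)⟩

/-- The target of `Φ` has the same dimension as its source, which supplies a direction whose image
under the differential is a multiple of `Φ z`. In that direction `log ‖Φ‖²` has a harmonic majorant
to fourth order, and `log ‖F‖` is itself harmonic near the point. -/
theorem isMaximalOn_logQuotient {E : Type*} [NormedAddCommGroup E] [InnerProductSpace ℂ E]
    [FiniteDimensional ℂ E] {Φ : E → E} {F : E → ℂ}
    (hΦ : Differentiable ℂ Φ) (hF : Differentiable ℂ F) :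
    IsMaximalOn (logQuotient Φ F) {z | F z ≠ 0 ∧ Φ z ≠ 0} := by
  have : CompleteSpace E := FiniteDimensional.complete ℂ E
  refine isMaximalOn_of_exists_direction (U := fun z => -Real.log ‖F z‖ + Real.log (‖Φ z‖ ^ 2))
    ((isPSHOn_logQuotient hΦ hF).mono fun z hz => hz.1) ?_
    (fun z hz => logQuotient_eq_coe hz.2) ?_
  · intro z hz
    refine ContinuousAt.continuousWithinAt ?_
    refine (hF.continuous.norm.continuousAt.log (norm_ne_zero_iff.2 hz.1)).neg.add
      ((hΦ.continuous.norm.pow 2).continuousAt.log ?_)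
    exact pow_ne_zero _ (norm_ne_zero_iff.2 hz.2)
  · rintro z ⟨hFz, hΦz⟩
    obtain ⟨ξ, hξ, c, hc⟩ :=
      exists_ne_zero_map_eq_smul (fderiv ℂ Φ z : E →ₗ[ℂ] E) hΦz
    have hline : ∀ t : ℂ, HasDerivAt (fun t : ℂ => z + t • ξ) ξ t := by
      intro t
      simpa using ((hasDerivAt_id t).smul_const ξ).const_add z
    have hlined : Differentiable ℂ fun t : ℂ => z + t • ξ := fun t => (hline t).differentiableAt
    have hder : deriv (fun t : ℂ => Φ (z + t • ξ)) 0 = c • Φ (z + (0 : ℂ) • ξ) := by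
      have h1 : HasFDerivAt Φ (fderiv ℂ Φ z) (z + (0 : ℂ) • ξ) := by
        rw [zero_smul, add_zero]
        exact (hΦ z).hasFDerivAt
      have h2 := h1.comp_hasDerivAt (0 : ℂ) (hline 0)
      rw [show deriv (fun t : ℂ => Φ (z + t • ξ)) 0 = _ from h2.deriv]
      simpa using hc
    obtain ⟨g₁, C, hg₁, hg₁d, hle₁⟩ := exists_log_norm_sq_le_of_deriv_eq_smul
      (h := fun t : ℂ => Φ (z + t • ξ)) (hΦ.comp hlined) (by simpa using hΦz) hder
    obtain ⟨g₂, hg₂, hg₂d, heq₂⟩ := exists_log_norm_eq_re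
      (F := fun t : ℂ => F (z + t • ξ)) (hF.comp hlined) (by simpa using hFz)
    refine ⟨ξ, hξ, fun t => g₁ t - g₂ t, C, by simp [hg₁, hg₂], ?_, ?_⟩
    · filter_upwards [hg₂d] with t ht using (hg₁d t).sub ht
    · filter_upwards [hle₁, heq₂] with t h1 h2
      simp only [zero_smul, add_zero] at h1 h2
      rw [h2, Complex.sub_re]
      linarith

/-! ### Complements of zero sets are Stein domains -/

/-- The complement of the zero set of an entire function which is not identically zero is
connected. -/
theorem isConnected_ne_zero {E : Type*} [NormedAddCommGroup E] [NormedSpace ℂ E] {F : E → ℂ}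
    (hF : Differentiable ℂ F) {a : E} (ha : F a ≠ 0) : IsConnected {z | F z ≠ 0} := by
  refine ⟨⟨a, ha⟩, isPreconnected_of_forall_pair ?_⟩
  intro x hx y hy
  -- On the complex line through `x` and `y` the zeros of `F` form a discrete, hence countable, set.
  -- Removing a countable set from the real plane leaves a connected set.
  have hline : Differentiable ℂ fun t : ℂ => x + t • (y - x) := by fun_prop
  have hFl : Differentiable ℂ fun t : ℂ => F (x + t • (y - x)) := hF.comp hline
  have hcod : (fun t : ℂ => F (x + t • (y - x))) ⁻¹' {0}ᶜ ∈ codiscrete ℂ :=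
    (hFl.differentiableOn.analyticOnNhd isOpen_univ).preimage_zero_mem_codiscrete (x := 0)
      (by simpa using hx)
  set S : Set ℂ := (fun t : ℂ => F (x + t • (y - x))) ⁻¹' {0}ᶜ with hS
  have hcount : Sᶜ.Countable := by
    have : DiscreteTopology ↑(Sᶜ ∩ Set.univ) := isDiscrete_iff_discreteTopology.mp
      (isDiscrete_of_codiscreteWithin ((compl_compl S).symm ▸ hcod))
    have h2 : (Sᶜ ∩ Set.univ).Countable :=
      TopologicalSpace.separableSpace_iff_countable.1 inferInstance
    rwa [Set.inter_univ] at h2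
  have hconn : IsPreconnected S := by
    have h := hcount.isConnected_compl_of_one_lt_rank (by
      rw [Complex.rank_real_complex]
      exact Cardinal.one_lt_two)
    rw [compl_compl] at h
    exact h.isPreconnected
  refine ⟨(fun t : ℂ => x + t • (y - x)) '' S, ?_, ⟨0, by simpa [hS] using hx, by simp⟩,
    ⟨1, by simpa [hS] using hy, by simp⟩, hconn.image _ hline.continuous.continuousOn⟩
  rintro _ ⟨t, ht, rfl⟩
  exact ht

/-- The complement of the zero set of a nonzero entire function on `ℂ^ι` is a Stein domain. -/
theorem isSteinDomain_ne_zero {ι : Type*} [Fintype ι] {F : EuclideanSpace ℂ ι → ℂ}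
    (hF : Differentiable ℂ F) {a : EuclideanSpace ℂ ι} (ha : F a ≠ 0) :
    IsSteinDomain {z | F z ≠ 0} := by
  have hopen : IsOpen {z | F z ≠ 0} := isOpen_ne_fun hF.continuous continuous_const
  refine ⟨hopen, isConnected_ne_zero hF ha, ?_⟩
  intro K hK hKX
  obtain ⟨R, hR, hRK⟩ := hK.isBounded.exists_pos_norm_le
  have hinv : ContinuousOn (fun z => (F z)⁻¹) K := hF.continuous.continuousOn.inv₀ hKX
  obtain ⟨D, hD⟩ := hK.exists_bound_of_continuousOn hinv
  have hcoord : ∀ z ∈ holHull K {z | F z ≠ 0}, ∀ i, ‖z i‖ ≤ R := by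
    intro z hz i
    refine hz.2 (fun w => w i) ?_ R fun w hw => (PiLp.norm_apply_le w i).trans (hRK w hw)
    have : Differentiable ℂ fun w : EuclideanSpace ℂ ι => w i := by fun_prop
    exact this.differentiableOn
  have hFinv : ∀ z ∈ holHull K {z | F z ≠ 0}, ‖(F z)⁻¹‖ ≤ D := by
    intro z hz
    exact hz.2 (fun w => (F w)⁻¹) (fun w hw => ((hF w).inv hw).differentiableWithinAt) D hD
  have hbdd : Bornology.IsBounded (holHull K {z | F z ≠ 0}) := by
    refine isBounded_iff_forall_norm_le.2 ⟨Real.sqrt (∑ _i : ι, R ^ 2), fun z hz => ?_⟩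
    rw [EuclideanSpace.norm_eq]
    refine Real.sqrt_le_sqrt (Finset.sum_le_sum fun i _ => ?_)
    have := hcoord z hz i
    gcongr
  refine isCompact_of_isClosed_isBounded (isClosed_of_closure_subset fun z hz => ?_) hbdd
  -- The bound on `1/F` over `K` passes to the hull as `1 ≤ D ‖F‖`, a closed condition, so limit
  -- points of the hull stay off the zero set.
  have hzF : F z ≠ 0 := by
    have hmem : z ∈ {z | 1 ≤ D * ‖F z‖} := by
      refine closure_minimal ?_ (isClosed_le continuous_const
        (continuous_const.mul hF.continuous.norm)) hz
      intro w hw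
      have h1 := hFinv w hw
      have h2 : 0 < ‖F w‖ := norm_pos_iff.2 hw.1
      rw [norm_inv, inv_le_iff_one_le_mul₀ h2] at h1
      exact h1
    intro h0
    have : (1 : ℝ) ≤ D * ‖F z‖ := hmem
    rw [h0, norm_zero, mul_zero] at this
    linarith
  refine ⟨hzF, fun g hg C hC => ?_⟩
  have hgc : ContinuousAt g z := (hg.differentiableAt (hopen.mem_nhds hzF)).continuousAt
  have hfreq := mem_closure_iff_frequently.1 hz
  by_contra hlt
  rw [not_le] at hlt
  obtain ⟨w, hw, hw'⟩ := (hfreq.and_eventually (hgc.norm.eventually (lt_mem_nhds hlt))).exists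
  exact (hw.2 g hg C hC).not_gt hw'

/-! ### Monic polynomials in one variable -/

/-- A monic polynomial of positive degree takes each value finitely often. -/
theorem finite_monic_eq {k : ℕ} (hk : 1 ≤ k) (a : ℕ → ℂ) (c : ℂ) :
    {w : ℂ | w ^ k + ∑ j ∈ Finset.Icc 1 k, a j * w ^ (k - j) = c}.Finite := by
  open Polynomial in
  let P : ℂ[X] := X ^ k + ∑ j ∈ Finset.Icc 1 k, C (a j) * X ^ (k - j) - C c
  have hP : P ≠ 0 := by
    intro h
    have h1 : P.coeff k = 1 := by
      have h2 : ∑ j ∈ Finset.Icc 1 k, (Polynomial.C (a j) * Polynomial.X ^ (k - j)).coeff k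
          = 0 := by
        refine Finset.sum_eq_zero fun j hj => ?_
        rw [Finset.mem_Icc] at hj
        rw [Polynomial.coeff_C_mul_X_pow, if_neg (by omega)]
      simp only [P, Polynomial.coeff_sub, Polynomial.coeff_add, Polynomial.finsetSum_coeff, h2,
        Polynomial.coeff_X_pow, Polynomial.coeff_C, if_neg (show k ≠ 0 by omega)]
      simp
    rw [h] at h1
    simp at h1
  refine P.roots.toFinset.finite_toSet.subset fun w hw => ?_
  simp only [Finset.mem_coe, Multiset.mem_toFinset, Polynomial.mem_roots hP, Polynomial.IsRoot.def]
  simp only [P, Polynomial.eval_sub, Polynomial.eval_add, Polynomial.eval_pow, Polynomial.eval_X,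
    Polynomial.eval_finsetSum, Polynomial.eval_mul, Polynomial.eval_C]
  rw [show _ = c from hw, sub_self]

/-- Points where a monic polynomial with bounded coefficients has a bounded value are bounded. -/
theorem norm_le_of_monic_le {k : ℕ} (hk : 1 ≤ k) {a : ℕ → ℂ} {w : ℂ} {M : ℝ}
    (ha : ∀ j ∈ Finset.Icc 1 k, ‖a j‖ ≤ M)
    (hw : ‖w ^ k + ∑ j ∈ Finset.Icc 1 k, a j * w ^ (k - j)‖ ≤ M) :
    ‖w‖ ≤ max 1 ((k + 1) * M) := by
  by_contra hlt
  rw [not_le, max_lt_iff] at hlt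
  obtain ⟨h1, h2⟩ := hlt
  have hM : 0 ≤ M := (norm_nonneg _).trans hw
  have hpow : 1 ≤ ‖w‖ ^ (k - 1) := one_le_pow₀ h1.le
  have hsum : ‖∑ j ∈ Finset.Icc 1 k, a j * w ^ (k - j)‖ ≤ k * (M * ‖w‖ ^ (k - 1)) := by
    refine (norm_sum_le_of_le (n := fun _ => M * ‖w‖ ^ (k - 1)) _ fun j hj => ?_).trans_eq ?_
    · rw [norm_mul, norm_pow]
      have h3 := ha j hj
      rw [Finset.mem_Icc] at hj
      have h4 : ‖w‖ ^ (k - j) ≤ ‖w‖ ^ (k - 1) := pow_le_pow_right₀ h1.le (by omega)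
      gcongr
    · simp
  have hk' : ‖w‖ ^ k = ‖w‖ * ‖w‖ ^ (k - 1) := by
    rw [← pow_succ']
    congr 1
    omega
  -- Since `‖w‖ > 1`, the right side is at most `(k + 1) M ‖w‖ ^ (k - 1)`, which is less than `‖w‖ ^
  -- k` once `‖w‖ > (k + 1) M`.
  have htri : ‖w‖ ^ k ≤ M + k * (M * ‖w‖ ^ (k - 1)) := by
    rw [← norm_pow]
    have h5 := norm_sub_le (w ^ k + ∑ j ∈ Finset.Icc 1 k, a j * w ^ (k - j))
      (∑ j ∈ Finset.Icc 1 k, a j * w ^ (k - j))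
    rw [add_sub_cancel_right] at h5
    linarith
  rw [hk'] at htri
  have h6 : M ≤ M * ‖w‖ ^ (k - 1) := le_mul_of_one_le_right hM hpow
  have h7 : (k + 1) * M * ‖w‖ ^ (k - 1) < ‖w‖ * ‖w‖ ^ (k - 1) := by gcongr
  linarith

/-! ### Weierstrass polynomials and the exhaustion function -/

variable {m : ℕ}

theorem differentiable_headCoords : Differentiable ℂ (headCoords (m := m)) := by
  rw [differentiable_euclidean]
  intro i
  change Differentiable ℂ fun z : EuclideanSpace ℂ (Fin (m + 1)) => z i.castSucc
  fun_prop

theorem differentiable_weierstrassPoly {k : ℕ} {f : ℕ → EuclideanSpace ℂ (Fin m) → ℂ}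
    (hf : ∀ j ∈ Finset.Icc 1 k, Differentiable ℂ (f j)) :
    Differentiable ℂ (weierstrassPoly k f) := by
  unfold weierstrassPoly
  refine Differentiable.add (by fun_prop) (Differentiable.fun_sum fun j hj => ?_)
  have := (hf j hj).comp (differentiable_headCoords (m := m))
  exact this.mul (by fun_prop)

/-- The map `('z, z_n) ↦ ('z, F(z) - 1)`. -/
def replaceLast (F : EuclideanSpace ℂ (Fin (m + 1)) → ℂ) (z : EuclideanSpace ℂ (Fin (m + 1))) :
    EuclideanSpace ℂ (Fin (m + 1)) :=
  z + (F z - 1 - z (Fin.last m)) • EuclideanSpace.single (Fin.last m) (1 : ℂ)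

theorem differentiable_replaceLast {F : EuclideanSpace ℂ (Fin (m + 1)) → ℂ}
    (hF : Differentiable ℂ F) : Differentiable ℂ (replaceLast F) := by
  unfold replaceLast
  fun_prop

theorem norm_sq_eq_headCoords (z : EuclideanSpace ℂ (Fin (m + 1))) :
    ‖z‖ ^ 2 = ‖headCoords z‖ ^ 2 + ‖z (Fin.last m)‖ ^ 2 := by
  rw [EuclideanSpace.norm_sq_eq, EuclideanSpace.norm_sq_eq, Fin.sum_univ_castSucc]
  rfl

theorem norm_replaceLast_sq (F : EuclideanSpace ℂ (Fin (m + 1)) → ℂ)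
    (z : EuclideanSpace ℂ (Fin (m + 1))) :
    ‖replaceLast F z‖ ^ 2 = ‖headCoords z‖ ^ 2 + ‖F z - 1‖ ^ 2 := by
  have h1 : headCoords (replaceLast F z) = headCoords z := by
    ext i
    simp [headCoords, replaceLast]
  have h2 : replaceLast F z (Fin.last m) = F z - 1 := by simp [replaceLast]
  rw [norm_sq_eq_headCoords, h1, h2]

theorem replaceLast_eq_zero_iff {F : EuclideanSpace ℂ (Fin (m + 1)) → ℂ}
    {z : EuclideanSpace ℂ (Fin (m + 1))} :
    replaceLast F z = 0 ↔ headCoords z = 0 ∧ F z = 1 := by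
  rw [← norm_eq_zero, ← sq_eq_zero_iff, norm_replaceLast_sq,
    add_eq_zero_iff_of_nonneg (sq_nonneg _) (sq_nonneg _), sq_eq_zero_iff, sq_eq_zero_iff,
    norm_eq_zero, norm_eq_zero, sub_eq_zero]

theorem specialExhaustion_eq_logQuotient (F : EuclideanSpace ℂ (Fin (m + 1)) → ℂ) :
    specialExhaustion F = logQuotient (replaceLast F) F := by
  ext z
  rw [specialExhaustion, logQuotient, norm_replaceLast_sq]

/-- The map `('z, z_n) ↦ ('z, F(z))` is proper, for a Weierstrass polynomial `F`. -/
theorem isBounded_of_weierstrassPoly_le {k : ℕ} (hk : 1 ≤ k)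
    {f : ℕ → EuclideanSpace ℂ (Fin m) → ℂ} (hf : ∀ j ∈ Finset.Icc 1 k, Differentiable ℂ (f j))
    (S : ℝ) :
    Bornology.IsBounded {z | ‖headCoords z‖ ≤ S ∧ ‖weierstrassPoly k f z‖ ≤ S} := by
  have hcomp := isCompact_closedBall (0 : EuclideanSpace ℂ (Fin m)) S
  -- The sum of the moduli gives one bound for all the coefficients on the ball.
  obtain ⟨M, hM⟩ := hcomp.exists_bound_of_continuousOn
    (f := fun x => ∑ j ∈ Finset.Icc 1 k, ‖f j x‖)
    (continuous_finsetSum _ fun j hj => (hf j hj).continuous.norm).continuousOn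
  refine isBounded_iff_forall_norm_le.2
    ⟨Real.sqrt (S ^ 2 + (max 1 ((k + 1) * max M S)) ^ 2), ?_⟩
  rintro z ⟨hz1, hz2⟩
  have hlast : ‖z (Fin.last m)‖ ≤ max 1 ((k + 1) * max M S) := by
    refine norm_le_of_monic_le hk (a := fun j => f j (headCoords z)) (fun j hj => ?_)
      (hz2.trans (le_max_right _ _))
    have h1 := hM (headCoords z) (by simpa using hz1)
    have h2 := Finset.single_le_sum (f := fun j => ‖f j (headCoords z)‖)
      (fun j _ => norm_nonneg _) hj
    exact h2.trans (((le_abs_self _).trans h1).trans (le_max_left _ _))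
  apply Real.le_sqrt_of_sq_le
  rw [norm_sq_eq_headCoords]
  gcongr

theorem isExhaustionOn_specialExhaustion {k : ℕ} (hk : 1 ≤ k)
    {f : ℕ → EuclideanSpace ℂ (Fin m) → ℂ} (hf : ∀ j ∈ Finset.Icc 1 k, Differentiable ℂ (f j)) :
    IsExhaustionOn (specialExhaustion (weierstrassPoly k f)) {z | weierstrassPoly k f z ≠ 0} := by
  intro C
  have hF := differentiable_weierstrassPoly hf
  set F := weierstrassPoly k f
  set B := Real.exp C with hB
  have hB0 : 0 < B := Real.exp_pos C
  refine ⟨{z | ‖headCoords z‖ ^ 2 + ‖F z - 1‖ ^ 2 ≤ B * ‖F z‖}, ?_, ?_, ?_⟩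
  · refine isCompact_of_isClosed_isBounded ?_ ?_
    · have h1 := (differentiable_headCoords (m := m)).continuous
      have h2 := hF.continuous
      exact isClosed_le (by fun_prop) (by fun_prop)
    · refine (isBounded_of_weierstrassPoly_le hk hf (B + 2)).subset fun z hz => ?_
      have hz' : ‖headCoords z‖ ^ 2 + ‖F z - 1‖ ^ 2 ≤ B * ‖F z‖ := hz
      have h1 : (‖F z‖ - 1) ^ 2 ≤ ‖F z - 1‖ ^ 2 := by
        have := abs_norm_sub_norm_le (F z) 1
        rw [norm_one] at this
        rw [← sq_abs]
        gcongr
      -- With `x = ‖F z‖`, the inequality `(x - 1)² ≤ B x` forces `x (x - 2) < B x`, which fails for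
      -- `x > B + 2`. Then `‖'z‖² ≤ B (B + 2) ≤ (B + 2)²`, so the same constant bounds `'z`.
      have h2 : ‖F z‖ ≤ B + 2 := by
        by_contra hlt
        rw [not_le] at hlt
        nlinarith [sq_nonneg ‖headCoords z‖]
      refine ⟨?_, h2⟩
      have h3 : ‖headCoords z‖ ^ 2 ≤ (B + 2) ^ 2 := by
        nlinarith [sq_nonneg ‖F z - 1‖]
      exact (abs_le_of_sq_le_sq' h3 (by positivity)).2
  -- At a zero of `F` the left side is at least `‖0 - 1‖² = 1` while the right side is `0`.
  · intro z hz h0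
    have hz' : ‖headCoords z‖ ^ 2 + ‖F z - 1‖ ^ 2 ≤ B * ‖F z‖ := hz
    rw [h0] at hz'
    norm_num at hz'
    nlinarith [sq_nonneg ‖headCoords z‖]
  · rintro z ⟨hz, hzC⟩
    have hFz : 0 < ‖F z‖ := norm_pos_iff.2 hz
    change ‖headCoords z‖ ^ 2 + ‖F z - 1‖ ^ 2 ≤ B * ‖F z‖
    rw [← norm_replaceLast_sq]
    by_cases h0 : replaceLast F z = 0
    · rw [h0, norm_zero, zero_pow two_ne_zero]
      positivity
    · rw [specialExhaustion_eq_logQuotient, logQuotient_eq_coe h0, EReal.coe_le_coe_iff] at hzC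
      have h1 : 0 < ‖replaceLast F z‖ ^ 2 := by
        have := norm_pos_iff.2 h0
        positivity
      rw [← Real.log_le_log_iff h1 (by positivity), Real.log_mul hB0.ne' hFz.ne', hB, Real.log_exp]
      linarith

theorem finite_headCoords_eq_zero_and_weierstrassPoly_eq {k : ℕ} (hk : 1 ≤ k)
    (f : ℕ → EuclideanSpace ℂ (Fin m) → ℂ) (c : ℂ) :
    {z | headCoords z = 0 ∧ weierstrassPoly k f z = c}.Finite := by
  refine Set.Finite.of_finite_image ((finite_monic_eq hk (fun j => f j 0) c).subset ?_)
    (f := fun z => z (Fin.last m)) ?_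
  · rintro _ ⟨z, ⟨hz, hzc⟩, rfl⟩
    rw [weierstrassPoly, hz] at hzc
    exact hzc
  · intro z hz w hw hzw
    have h : headCoords z = headCoords w := hz.1.trans hw.1.symm
    ext i
    refine Fin.lastCases hzw (fun j => ?_) i
    exact congrArg (fun x : EuclideanSpace ℂ (Fin m) => x j) h

theorem exists_weierstrassPoly_ne_zero {k : ℕ} (hk : 1 ≤ k)
    (f : ℕ → EuclideanSpace ℂ (Fin m) → ℂ) : ∃ a, weierstrassPoly k f a ≠ 0 := by
  obtain ⟨w, hw⟩ := (finite_monic_eq hk (fun j => f j 0) 0).infinite_compl.nonempty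
  refine ⟨EuclideanSpace.single (Fin.last m) w, ?_⟩
  have hhead : headCoords (EuclideanSpace.single (Fin.last m) w) = 0 := by
    ext i
    simp [headCoords]
  rw [weierstrassPoly, hhead]
  simpa using hw

end

end SStar

/-! ### The complement of a Weierstrass hypersurface -/

theorem mainTheorem2 (m k : ℕ) (hk : 1 ≤ k)
    (f : ℕ → EuclideanSpace ℂ (Fin m) → ℂ)
    (hf : ∀ j ∈ Finset.Icc 1 k, Differentiable ℂ (f j))
    (A : Set (EuclideanSpace ℂ (Fin (m + 1))))
    (hA : A = {z | SStar.weierstrassPoly k f z = 0})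
    (ρ : EuclideanSpace ℂ (Fin (m + 1)) → EReal)
    (hρ : ρ = SStar.specialExhaustion (SStar.weierstrassPoly k f))
    (Q : Set (EuclideanSpace ℂ (Fin (m + 1))))
    (hQ : Q = {z | SStar.headCoords z = 0 ∧ SStar.weierstrassPoly k f z = 1}) :
    SStar.IsSStarParabolic Aᶜ ∧
      SStar.IsPSHOn ρ Aᶜ ∧ ContinuousOn ρ Aᶜ ∧ SStar.IsExhaustionOn ρ Aᶜ ∧
      Q.Finite ∧ Q ⊆ Aᶜ ∧ (∀ z ∈ Aᶜ, ρ z = ⊥ ↔ z ∈ Q) ∧ SStar.IsMaximalOn ρ (Aᶜ \ Q) := by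
  have hF := SStar.differentiable_weierstrassPoly hf
  have hΦ := SStar.differentiable_replaceLast hF
  have hAc : Aᶜ = {z | SStar.weierstrassPoly k f z ≠ 0} := by rw [hA]; rfl
  have hexh : SStar.IsExhaustionOn ρ Aᶜ := by
    rw [hρ, hAc]
    exact SStar.isExhaustionOn_specialExhaustion hk hf
  rw [SStar.specialExhaustion_eq_logQuotient] at hρ
  have hpsh : SStar.IsPSHOn ρ Aᶜ := by
    rw [hρ, hAc]
    exact SStar.isPSHOn_logQuotient hΦ hF
  have hcont : ContinuousOn ρ Aᶜ := by
    rw [hρ, hAc]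
    exact SStar.continuousOn_logQuotient hΦ.continuous hF.continuous
  have hQfin : Q.Finite := by
    rw [hQ]
    exact SStar.finite_headCoords_eq_zero_and_weierstrassPoly_eq hk f 1
  have hQA : Q ⊆ Aᶜ := by
    rw [hQ, hAc]
    rintro z ⟨-, hz⟩ h0
    exact one_ne_zero (hz.symm.trans h0)
  have hbot : ∀ z ∈ Aᶜ, ρ z = ⊥ ↔ z ∈ Q := by
    intro z _
    rw [hρ, hQ, SStar.logQuotient_eq_bot_iff, SStar.replaceLast_eq_zero_iff]
    rfl
  have hmax : SStar.IsMaximalOn ρ (Aᶜ \ Q) := by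
    have hset : Aᶜ \ Q = {z | SStar.weierstrassPoly k f z ≠ 0 ∧
        SStar.replaceLast (SStar.weierstrassPoly k f) z ≠ 0} := by
      ext z
      rw [hAc, hQ, Set.mem_sdiff, Set.mem_ofPred_eq, Set.mem_ofPred_eq, Set.mem_ofPred_eq, Ne,
        Ne, SStar.replaceLast_eq_zero_iff]
    rw [hρ, hset]
    exact SStar.isMaximalOn_logQuotient hΦ hF
  obtain ⟨a, ha⟩ := SStar.exists_weierstrassPoly_ne_zero hk f
  have hstein : SStar.IsSteinDomain Aᶜ := by
    rw [hAc]
    exact SStar.isSteinDomain_ne_zero hF ha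
  exact ⟨⟨hstein, ρ, hpsh, hcont, hexh, Q, hQfin.isCompact, hQA, hmax⟩, hpsh, hcont, hexh, hQfin,
    hQA, hbot, hmax⟩
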